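/- Let $f,g$ be real functions that are analytic in a neighborhood of $0\in\mathbb{R}$, with $g'(0)=1$, and suppose that the origin is a center of the planar system $$\dot x=y,\qquad \dot y=-g(x)-f(x)\,y^2,$$ equivalent to $(E)\colon\ \ddot x+f(x)\dot x^2+g(x)=0$; that is, the origin is an equilibrium and every other point of some neighborhood of it lies on a cycle (a nonconstant periodic orbit). The period function $T$ assigns to each cycle its minimal period. It increases (respectively decreases) near $0$ if there is a neighborhood $U$ of the origin such that $T(\gamma_1)<T(\gamma_2)$ (respectively $T(\gamma_1)>T(\gamma_2)$) for all cycles $\gamma_1,\gamma_2\subset U$ with $\gamma_1$ enclosed by $\gamma_2$. The center is isochronous if $T$ is constant on the cycles contained in some neighborhood of the origin. Put $$S(f,g)=5g''(0)^2+10g''(0)f(0)+8f(0)^2-3g'''(0)-6f'(0).$$ Then: (a) if $S(f,g)>0$, then $T$ increases near $0$; (b) if $S(f,g)<0$, then $T$ decreases near $0$; (c) if $0$ is an isochronous center of $(E)$, then $S(f,g)=0$. -/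

import Mathlib

open Set Filter Topology

namespace LienardType

/-- The planar vector field of the system `x' = y`, `y' = -g(x) - f(x) y ^ 2`, which is the
first-order form of the equation `x'' + f(x) x' ^ 2 + g(x) = 0`. -/
def field (f g : ℝ → ℝ) (p : ℝ × ℝ) : ℝ × ℝ :=
  (p.2, -g p.1 - f p.1 * p.2 ^ 2)

/-- `c` is a solution of the system, defined for all times. -/
def IsSolution (f g : ℝ → ℝ) (c : ℝ → ℝ × ℝ) : Prop :=
  IsIntegralCurve c (fun _ => field f g)

/-- `γ` is a cycle (a closed orbit that is not an equilibrium) of minimal period `T`. A constant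
solution has no least positive period, so it is excluded. -/
def IsCycle (f g : ℝ → ℝ) (γ : Set (ℝ × ℝ)) (T : ℝ) : Prop :=
  ∃ c : ℝ → ℝ × ℝ, IsSolution f g c ∧ range c = γ ∧
    IsLeast {τ : ℝ | 0 < τ ∧ Function.Periodic c τ} T

/-- The origin is a center: it is an equilibrium, and every other point of some neighborhood of
it lies on a cycle. -/
def IsCenter (f g : ℝ → ℝ) : Prop :=
  field f g 0 = 0 ∧ ∀ᶠ p in 𝓝[≠] (0 : ℝ × ℝ), ∃ γ T, p ∈ γ ∧ IsCycle f g γ T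

/-- The region enclosed by a closed curve: the union of the bounded components of its
complement. -/
def inside (γ : Set (ℝ × ℝ)) : Set (ℝ × ℝ) :=
  {p | p ∉ γ ∧ Bornology.IsBounded (connectedComponentIn γᶜ p)}

/-- The period function is strictly increasing near the origin: among the cycles in some
neighborhood of the origin, a cycle enclosed by another one has a smaller period. -/
def PeriodIncreasesNearZero (f g : ℝ → ℝ) : Prop :=
  ∃ U ∈ 𝓝 (0 : ℝ × ℝ), ∀ γ₁ γ₂ T₁ T₂, IsCycle f g γ₁ T₁ → IsCycle f g γ₂ T₂ →
    γ₁ ⊆ U → γ₂ ⊆ U → γ₁ ⊆ inside γ₂ → T₁ < T₂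

/-- The period function is strictly decreasing near the origin. -/
def PeriodDecreasesNearZero (f g : ℝ → ℝ) : Prop :=
  ∃ U ∈ 𝓝 (0 : ℝ × ℝ), ∀ γ₁ γ₂ T₁ T₂, IsCycle f g γ₁ T₁ → IsCycle f g γ₂ T₂ →
    γ₁ ⊆ U → γ₂ ⊆ U → γ₁ ⊆ inside γ₂ → T₂ < T₁

/-- The origin is an isochronous center: it is a center, and the period function is constant
on the cycles in some neighborhood of the origin. -/
def IsIsochronousCenter (f g : ℝ → ℝ) : Prop :=
  IsCenter f g ∧ ∃ T₀ : ℝ, ∃ U ∈ 𝓝 (0 : ℝ × ℝ), ∀ γ T, IsCycle f g γ T → γ ⊆ U → T = T₀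

/-- `S(f, g) = 5 g''(0)² + 10 g''(0) f(0) + 8 f(0)² - 3 g'''(0) - 6 f'(0)`. -/
noncomputable def S (f g : ℝ → ℝ) : ℝ :=
  5 * iteratedDeriv 2 g 0 ^ 2 + 10 * iteratedDeriv 2 g 0 * f 0 + 8 * f 0 ^ 2
    - 3 * iteratedDeriv 3 g 0 - 6 * deriv f 0

end LienardType

/-! Let `F' = f`, `F 0 = 0`, and put `w = y * exp F`, so that `w' = -g * exp F` along solutions. Let
`s` be the signed root of the potential, `s ^ 2 = 2 * ∫ g * exp (2 * F)`, and define `P` by `s = g *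
exp F * P`. Then `s' = w / P` and `w' = -s / P` in time: orbits are circles in the `(s, w)` plane,
traversed with angular speed `1 / P`. The circle of radius `r` thus has period `T(r) = ∫ p (r cos θ)
dθ` over `[0, 2π]`, where `p` is `P` expressed as a function of `s`.

Averaging `p` with its reflection does not change this integral. If `p'` is strictly increasing, the
averaged function strictly increases in `|v|`, so `T` strictly increases with `r`; the decreasing
case is symmetric. Since `p''(0) = S / 12` (`singular_linear_jet`), the sign of `S` decides.
Constant `T` excludes both signs, which gives (c).

The period formula is `exists_radius`; `radius_lt_of_subset_inside` turns enclosure of cycles into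
an inequality of radii. -/

/-! ### The analytic function `W = P ^ 2` and its jet at the origin. -/

theorem AnalyticAt.exists_primitive_zero {f : ℝ → ℝ} (hf : AnalyticAt ℝ f 0) :
    ∃ F : ℝ → ℝ, AnalyticAt ℝ F 0 ∧ F 0 = 0 ∧ ∀ᶠ x in 𝓝 0, HasDerivAt F (f x) x := by
  obtain ⟨p, r, hp⟩ := hf
  obtain ⟨ρ, hρ0, hρr⟩ := ENNReal.lt_iff_exists_nnreal_btwn.1 hp.r_pos
  have hρ : 0 < (ρ : ℝ) := by exact_mod_cast hρ0
  have hsum : Summable fun n => ‖p n‖ * (ρ : ℝ) ^ n :=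
    p.summable_norm_mul_pow (hρr.trans_le hp.r_le)
  have hcoeff : ∀ n, ‖p.coeff n‖ = ‖p n‖ := fun n => p.norm_apply_eq_norm_coef.symm
  set b : ℕ → ℝ := fun n => p.coeff n / (n + 1) with hb
  have hbn : ∀ n, ‖b n‖ ≤ ‖p n‖ := by
    intro n
    rw [hb, norm_div, hcoeff]
    refine div_le_self (norm_nonneg _) ?_
    rw [Real.norm_of_nonneg (by positivity)]
    linarith [(n.cast_nonneg : (0 : ℝ) ≤ n)]
  set q := FormalMultilinearSeries.ofScalars ℝ b with hq
  have hqr : (ρ : ENNReal) ≤ q.radius := by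
    apply q.le_radius_of_summable_norm
    refine Summable.of_nonneg_of_le (fun n => by positivity) (fun n => ?_) hsum
    gcongr
    rw [hq, FormalMultilinearSeries.ofScalars_norm]
    exact hbn n
  have hG : AnalyticAt ℝ q.sum 0 :=
    (q.hasFPowerSeriesOnBall (hρ0.trans_le hqr)).analyticAt
  refine ⟨fun x => x * q.sum x, analyticAt_id.mul hG, by simp, ?_⟩
  have hball : Metric.ball (0 : ℝ) ρ ∈ 𝓝 (0 : ℝ) := Metric.ball_mem_nhds _ hρ
  filter_upwards [hball] with x hx
  have hterm : ∀ n y, HasDerivAt (fun z : ℝ => b n * z ^ (n + 1)) (p.coeff n * y ^ n) y := by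
    intro n y
    have h := (hasDerivAt_pow (n + 1) y).const_mul (b n)
    refine h.congr_deriv ?_
    rw [hb]
    have : (n : ℝ) + 1 ≠ 0 := by positivity
    push_cast
    field_simp
  have key := hasDerivAt_tsum_of_isPreconnected hsum Metric.isOpen_ball
    (convex_ball (0 : ℝ) (ρ : ℝ)).isPreconnected (fun n y _ => hterm n y)
    (fun n y hy => by
      rw [norm_mul, hcoeff, norm_pow]
      have : ‖y‖ ≤ ρ := by simpa using (mem_ball_zero_iff.1 hy).le
      gcongr) (Metric.mem_ball_self hρ) (by simp) hx
  have hf : ∑' n, p.coeff n * x ^ n = f x := by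
    have hx' : x ∈ Metric.eball (0 : ℝ) r := by
      rw [Metric.mem_eball, edist_zero_right]
      refine lt_trans ?_ hρr
      rw [mem_ball_zero_iff] at hx
      rw [enorm_eq_nnnorm]
      exact_mod_cast hx
    have := hp.hasSum hx'
    simp only [zero_add, FormalMultilinearSeries.apply_eq_pow_smul_coeff, smul_eq_mul] at this
    rw [← this.tsum_eq]
    exact tsum_congr fun n => mul_comm _ _
  rw [hf] at key
  refine key.congr_of_eventuallyEq (Eventually.of_forall fun z => ?_)
  change z * q.sum z = _
  rw [FormalMultilinearSeries.sum, ← tsum_mul_left]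
  refine tsum_congr fun n => ?_
  rw [hq, FormalMultilinearSeries.ofScalars_apply_eq]
  simp [pow_succ]
  ring

/-- The square of the reparametrised period integrand, characterised by a singular linear
differential equation. -/
theorem exists_analyticAt_singular_linear {f g : ℝ → ℝ} (hf : AnalyticAt ℝ f 0)
    (hg : AnalyticAt ℝ g 0) (hg0 : g 0 = 0) (hg' : deriv g 0 = 1) :
    ∃ W : ℝ → ℝ, AnalyticAt ℝ W 0 ∧
      ∀ᶠ x in 𝓝 0, W x * (deriv g x + f x * g x) + g x * deriv W x / 2 = 1 := by
  obtain ⟨F, hF, hF0, hF'⟩ := hf.exists_primitive_zero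
  have ha : AnalyticAt ℝ (fun x => 2 * (g x * Real.exp (2 * F x))) 0 := by fun_prop
  obtain ⟨A, hA, hA0, hA'⟩ := ha.exists_primitive_zero
  have hAd : deriv A 0 = 0 := by rw [hA'.self_of_nhds.deriv, hg0]; simp
  have dsl : ∀ {u : ℝ → ℝ}, AnalyticAt ℝ u 0 → AnalyticAt ℝ (dslope u 0) 0 := by
    rintro u ⟨p, hp⟩
    exact hp.has_fpower_series_dslope_fslope.analyticAt
  -- Dividing out the simple zero of `g` and the double zero of `A` makes `W = A / (g ^ 2 * exp (2 *
  -- F))` visibly analytic at `0`.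
  set h := dslope g 0 with hh
  set B := dslope (dslope A 0) 0 with hB
  have hh0 : h 0 = 1 := by rw [hh, dslope_same, hg']
  have hgh : ∀ x, g x = x * h x := fun x => by
    have := sub_smul_dslope g 0 x
    rw [hg0] at this
    simpa using this.symm
  have hAB : ∀ x, A x = x ^ 2 * B x := fun x => by
    have h1 := sub_smul_dslope A 0 x
    have h2 := sub_smul_dslope (dslope A 0) 0 x
    rw [dslope_same, hAd] at h2
    rw [hA0] at h1
    simp only [sub_zero, smul_eq_mul] at h1 h2
    rw [← h1, ← h2]; ring
  have hhan : AnalyticAt ℝ h 0 := dsl hg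
  have hBan : AnalyticAt ℝ B 0 := dsl (dsl hA)
  have hWan : AnalyticAt ℝ (fun x => B x * Real.exp (-(2 * F x)) / h x ^ 2) 0 := by
    have : h 0 ^ 2 ≠ 0 := by rw [hh0]; norm_num
    fun_prop (disch := assumption)
  refine ⟨_, hWan, ?_⟩
  set W := fun x => B x * Real.exp (-(2 * F x)) / h x ^ 2 with hW
  have hne : ∀ᶠ x in 𝓝 (0 : ℝ), h x ≠ 0 :=
    hhan.continuousAt.eventually_ne (by rw [hh0]; norm_num)
  have hrel : ∀ᶠ x in 𝓝 (0 : ℝ), g x ^ 2 * Real.exp (2 * F x) * W x = A x := by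
    filter_upwards [hne] with x hx
    rw [hAB, hgh]
    simp only [hW, Real.exp_neg]
    field_simp
  have hpunct : ∀ᶠ x in 𝓝[≠] (0 : ℝ),
      W x * (deriv g x + f x * g x) + g x * deriv W x / 2 = 1 := by
    filter_upwards [hrel.eventually_nhds.filter_mono nhdsWithin_le_nhds,
      hF'.filter_mono nhdsWithin_le_nhds, hA'.filter_mono nhdsWithin_le_nhds,
      hne.filter_mono nhdsWithin_le_nhds,
      hg.eventually_analyticAt.filter_mono nhdsWithin_le_nhds,
      hWan.eventually_analyticAt.filter_mono nhdsWithin_le_nhds, self_mem_nhdsWithin]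
      with x h1 h2 h3 h4 h5 h6 h7
    have hgx : g x ≠ 0 := by rw [hgh]; exact mul_ne_zero h7 h4
    have d1 := ((h5.differentiableAt.hasDerivAt.pow 2).mul ((h2.const_mul 2).exp)).mul
      h6.differentiableAt.hasDerivAt
    have d2 := h3.congr_of_eventuallyEq h1
    have := d1.unique d2
    have he := Real.exp_ne_zero (2 * F x)
    -- The differential equation is the derivative of `g ^ 2 * exp (2 * F) * W = A`, divided by `2 *
    -- g * exp (2 * F)`; hence `x ≠ 0` at this stage.
    have h8 : (2 * (g x * Real.exp (2 * F x))) *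
        (W x * (deriv g x + f x * g x) + g x * deriv W x / 2) =
        (2 * (g x * Real.exp (2 * F x))) * 1 := by
      rw [mul_one]
      refine Eq.trans ?_ this
      simp
      ring
    exact mul_left_cancel₀ (by positivity) h8
  have hcont : AnalyticAt ℝ
      (fun x => W x * (deriv g x + f x * g x) + g x * deriv W x / 2) 0 := by
    have := hg.deriv
    have := hWan.deriv
    fun_prop (disch := norm_num)
  -- The identity theorem fills in the point `0`.
  exact (hcont.frequently_eq_iff_eventually_eq analyticAt_const).1 hpunct.frequently

/-- Because `g 0 = 0`, the equation and its first two derivatives at `0` determine `W 0`, `W' 0`,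
`W'' 0` in turn. The function differentiated here is `R = dP/ds`, and `ds/dx = 1` at `0`, so the
value is also the second derivative of `P` with respect to `s`. -/
theorem singular_linear_jet {f g W F : ℝ → ℝ} (hf : AnalyticAt ℝ f 0)
    (hg : AnalyticAt ℝ g 0) (hg0 : g 0 = 0) (hg' : deriv g 0 = 1) (hW : AnalyticAt ℝ W 0)
    (hF0 : F 0 = 0) (hF : HasDerivAt F (f 0) 0)
    (hode : ∀ᶠ x in 𝓝 0, W x * (deriv g x + f x * g x) + g x * deriv W x / 2 = 1) :
    W 0 = 1 ∧ HasDerivAt (fun x => deriv W x * Real.exp (-F x) / 2)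
      (LienardType.S f g / 12) 0 := by
  have hW0 : W 0 = 1 := by
    have := hode.self_of_nhds
    simpa [hg0, hg'] using this
  refine ⟨hW0, ?_⟩
  have D : ∀ {u : ℝ → ℝ} {x : ℝ}, AnalyticAt ℝ u x → HasDerivAt u (deriv u x) x :=
    fun h => h.differentiableAt.hasDerivAt
  have hode1 : ∀ᶠ x in 𝓝 0, deriv W x * (deriv g x + f x * g x) +
      W x * (deriv (deriv g) x + (deriv f x * g x + f x * deriv g x)) +
      (deriv g x * deriv W x + g x * deriv (deriv W) x) / 2 = 0 := by
    filter_upwards [hode.eventually_nhds, hf.eventually_analyticAt, hg.eventually_analyticAt,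
      hW.eventually_analyticAt] with x h1 h2 h3 h4
    exact (((D h4).mul ((D h3.deriv).add ((D h2).mul (D h3)))).add
      (((D h3).mul (D h4.deriv)).div_const 2)).unique
      ((hasDerivAt_const x (1 : ℝ)).congr_of_eventuallyEq h1)
  have e1 := hode1.self_of_nhds
  have e2 := ((((D hW.deriv).mul ((D hg.deriv).add ((D hf).mul (D hg)))).add
    ((D hW).mul ((D hg.deriv.deriv).add (((D hf.deriv).mul (D hg)).add
      ((D hf).mul (D hg.deriv)))))).add
    ((((D hg.deriv).mul (D hW.deriv)).add ((D hg).mul (D hW.deriv.deriv))).div_const 2)).unique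
    ((hasDerivAt_const (0 : ℝ) (0 : ℝ)).congr_of_eventuallyEq hode1)
  refine (((D hW.deriv).mul hF.neg.exp).div_const 2).congr_deriv ?_
  simp only [Pi.add_apply, Pi.mul_apply, hg0, hg', hW0, LienardType.S, iteratedDeriv_succ,
    iteratedDeriv_zero, Pi.neg_apply, hF0, neg_zero, Real.exp_zero] at e1 e2 ⊢
  have h1 : deriv W 0 = -(2 / 3) * (deriv (deriv g) 0 + f 0) := by linarith
  rw [h1] at e2 ⊢
  linear_combination e2 / 4

/-! ### The normal form: a rotation field with variable speed. -/

namespace LienardType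

/-- Near the origin, the functions `s x` and `y * exp (F x)` are coordinates in which the field
is the rotation field divided by `P x`; along `s`, the derivative of `P` is `R`. -/
structure IsNormalForm (f g : ℝ → ℝ) (δ : ℝ) (F s P R : ℝ → ℝ) : Prop where
  pos : 0 < δ
  F_zero : F 0 = 0
  s_zero : s 0 = 0
  hasDerivAt_F : ∀ x ∈ Ioo (-δ) δ, HasDerivAt F (f x) x
  hasDerivAt_s : ∀ x ∈ Ioo (-δ) δ, HasDerivAt s (Real.exp (F x) / P x) x
  s_eq : ∀ x ∈ Ioo (-δ) δ, s x = g x * Real.exp (F x) * P x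
  P_pos : ∀ x ∈ Ioo (-δ) δ, 0 < P x
  P_le : ∀ x ∈ Ioo (-δ) δ, P x ≤ 2
  hasDerivAt_P : ∀ x ∈ Ioo (-δ) δ, HasDerivAt P (R x * (Real.exp (F x) / P x)) x

/-- Take `P = √W` and `s = g * exp F * P`; the equation for `W` is exactly what gives `s' = exp F /
P`. The derivative of `R` is continuous with value `S / 12` at `0`, so it keeps a nonzero sign on a
small interval. -/
theorem exists_isNormalForm {f g : ℝ → ℝ} (hf : AnalyticAt ℝ f 0)
    (hg : AnalyticAt ℝ g 0) (hg0 : g 0 = 0) (hg' : deriv g 0 = 1) :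
    ∃ δ F s P R, IsNormalForm f g δ F s P R ∧ (0 < S f g → StrictMonoOn R (Ioo (-δ) δ)) ∧
      (S f g < 0 → StrictAntiOn R (Ioo (-δ) δ)) := by
  obtain ⟨F, hF, hF0, hF'⟩ := hf.exists_primitive_zero
  obtain ⟨W, hW, hode⟩ := exists_analyticAt_singular_linear hf hg hg0 hg'
  obtain ⟨hW0, hR'⟩ := singular_linear_jet hf hg hg0 hg' hW hF0 hF'.self_of_nhds hode
  have hR : AnalyticAt ℝ (fun x => deriv W x * Real.exp (-F x) / 2) 0 := by
    have := hW.deriv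
    fun_prop (disch := norm_num)
  set R := fun x => deriv W x * Real.exp (-F x) / 2 with hRdef
  have hsign : ∀ᶠ x in 𝓝 (0 : ℝ), (0 < S f g → 0 < deriv R x) ∧ (S f g < 0 → deriv R x < 0) := by
    have hc := hR.deriv.continuousAt
    rcases lt_trichotomy (S f g) 0 with h | h | h
    · filter_upwards [hc.eventually_lt (continuousAt_const (y := 0)) (by rw [hR'.deriv]; linarith)]
        with x hx
      exact ⟨fun h' => absurd h h'.le.not_gt, fun _ => hx⟩
    · simp [h]
    · filter_upwards [(continuousAt_const (y := 0)).eventually_lt hc (by rw [hR'.deriv]; linarith)]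
        with x hx
      exact ⟨fun _ => hx, fun h' => absurd h h'.le.not_gt⟩
  -- This gives `P ≤ 2`, hence an angular speed of at least `1 / 2`.
  have hWlt : ∀ᶠ x in 𝓝 (0 : ℝ), W x < 4 :=
    hW.continuousAt.eventually_lt continuousAt_const (by rw [hW0]; norm_num)
  have hWpos : ∀ᶠ x in 𝓝 (0 : ℝ), 0 < W x :=
    continuousAt_const.eventually_lt hW.continuousAt (by rw [hW0]; norm_num)
  have hall := hsign.and (hWlt.and (hWpos.and (hode.and (hF'.and (hg.eventually_analyticAt.and
    (hW.eventually_analyticAt.and hR.eventually_analyticAt))))))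
  obtain ⟨δ, hδ, hall⟩ := Metric.eventually_nhds_iff_ball.1 hall
  rw [Real.ball_eq_Ioo, zero_sub, zero_add] at hall
  refine ⟨δ, F, fun x => g x * Real.exp (F x) * Real.sqrt (W x), fun x => Real.sqrt (W x), R,
    ?_, ?_, ?_⟩
  · refine ⟨hδ, hF0, by simp [hg0], fun x hx => (hall x hx).2.2.2.2.1, ?_, fun _ _ => rfl, ?_, ?_, ?_⟩
    · intro x hx
      obtain ⟨-, -, h1, h2, h3, h4, h5, -⟩ := hall x hx
      refine ((h4.differentiableAt.hasDerivAt.mul h3.exp).mul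
        (h5.differentiableAt.hasDerivAt.sqrt h1.ne')).congr_deriv ?_
      have h6 := Real.sqrt_pos.2 h1
      have h7 := Real.sq_sqrt h1.le
      simp only [Pi.mul_apply]
      field_simp
      rw [h7]
      linear_combination 2 * h2
    · exact fun x hx => Real.sqrt_pos.2 (hall x hx).2.2.1
    · intro x hx
      exact Real.sqrt_le_iff.2 ⟨by norm_num, by linarith [(hall x hx).2.1]⟩
    · intro x hx
      obtain ⟨-, -, h1, h2, h3, h4, h5, -⟩ := hall x hx
      refine (h5.differentiableAt.hasDerivAt.sqrt h1.ne').congr_deriv ?_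
      have h6 := Real.sqrt_pos.2 h1
      simp only [hRdef, Real.exp_neg]
      field_simp
  · intro h
    refine strictMonoOn_of_deriv_pos (convex_Ioo _ _)
      (fun x hx => (hall x hx).2.2.2.2.2.2.2.continuousAt.continuousWithinAt) fun x hx => ?_
    rw [interior_Ioo] at hx
    exact (hall x hx).1.1 h
  · intro h
    refine strictAntiOn_of_deriv_neg (convex_Ioo _ _)
      (fun x hx => (hall x hx).2.2.2.2.2.2.2.continuousAt.continuousWithinAt) fun x hx => ?_
    rw [interior_Ioo] at hx
    exact (hall x hx).1.2 h

end LienardType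

/-! ### Monotonicity of the period integral in the radius. -/

/-- The shift `θ ↦ θ + π` changes the sign of the cosine and preserves the integral over a full
period. -/
theorem integral_comp_mul_cos_symmetrize (p : ℝ → ℝ) (r : ℝ)
    (hp : ContinuousOn p (Icc (-r) r)) (hr : 0 ≤ r) :
    ∫ θ in (0 : ℝ)..(2 * Real.pi), p (r * Real.cos θ) =
      ∫ θ in (0 : ℝ)..(2 * Real.pi), (p (r * Real.cos θ) + p (-(r * Real.cos θ))) / 2 := by
  have hmem : ∀ θ, r * Real.cos θ ∈ Icc (-r) r := fun θ =>
    ⟨by nlinarith [Real.neg_one_le_cos θ], by nlinarith [Real.cos_le_one θ]⟩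
  have hmem' : ∀ θ, -(r * Real.cos θ) ∈ Icc (-r) r := fun θ =>
    ⟨by linarith [(hmem θ).2], by linarith [(hmem θ).1]⟩
  have c1 : Continuous fun θ => p (r * Real.cos θ) :=
    hp.comp_continuous (by fun_prop) hmem
  have c2 : Continuous fun θ => p (-(r * Real.cos θ)) :=
    hp.comp_continuous (by fun_prop) hmem'
  have hper : Function.Periodic (fun θ => p (r * Real.cos θ)) (2 * Real.pi) := fun θ => by
    simp only [Real.cos_add_two_pi]
  have h : ∫ θ in (0 : ℝ)..(2 * Real.pi), p (-(r * Real.cos θ)) =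
      ∫ θ in (0 : ℝ)..(2 * Real.pi), p (r * Real.cos θ) := by
    have := intervalIntegral.integral_comp_add_right (a := 0) (b := 2 * Real.pi)
      (fun θ => p (r * Real.cos θ)) Real.pi
    simp only [Real.cos_add_pi, mul_neg] at this
    rw [this, zero_add, add_comm (2 * Real.pi), hper.intervalIntegral_add_eq Real.pi 0, zero_add]
  rw [intervalIntegral.integral_div, intervalIntegral.integral_add
    (c1.intervalIntegrable _ _) (c2.intervalIntegrable _ _), h]
  ring

theorem integral_comp_mul_cos_lt {p p' : ℝ → ℝ} {r₁ r₂ : ℝ} (h0 : 0 ≤ r₁) (h12 : r₁ < r₂)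
    (hp : ∀ x ∈ Icc (-r₂) r₂, HasDerivAt p (p' x) x) (hp' : StrictMonoOn p' (Icc (-r₂) r₂)) :
    ∫ θ in (0 : ℝ)..(2 * Real.pi), p (r₁ * Real.cos θ) <
      ∫ θ in (0 : ℝ)..(2 * Real.pi), p (r₂ * Real.cos θ) := by
  have hc : ContinuousOn p (Icc (-r₂) r₂) := fun x hx => (hp x hx).continuousAt.continuousWithinAt
  have hsub : Icc (-r₁) r₁ ⊆ Icc (-r₂) r₂ := Icc_subset_Icc (by linarith) h12.le
  set q : ℝ → ℝ := fun x => (p x + p (-x)) / 2 with hq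
  have hneg : ∀ x ∈ Icc (-r₂) r₂, -x ∈ Icc (-r₂) r₂ := fun x hx =>
    ⟨by linarith [hx.2], by linarith [hx.1]⟩
  have hqd : ∀ x ∈ Icc (-r₂) r₂, HasDerivAt q ((p' x - p' (-x)) / 2) x := fun x hx => by
    have := (hp (-x) (hneg x hx)).comp x (hasDerivAt_neg x)
    refine (((hp x hx).add this).div_const 2).congr_deriv (by ring)
  have hqc : ContinuousOn q (Icc (-r₂) r₂) := fun x hx =>
    (hqd x hx).continuousAt.continuousWithinAt
  -- For `x > 0`, `q' x = (p' x - p' (-x)) / 2` is positive since `p'` is strictly increasing.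
  have hqmono : StrictMonoOn q (Icc 0 r₂) := by
    have hs : Icc 0 r₂ ⊆ Icc (-r₂) r₂ := Icc_subset_Icc (by linarith) le_rfl
    refine strictMonoOn_of_deriv_pos (convex_Icc _ _) (hqc.mono hs) fun x hx => ?_
    have hx' := hs (interior_subset hx)
    rw [interior_Icc] at hx
    rw [(hqd x hx').deriv]
    have := hp' (hneg x hx') hx' (by linarith [hx.1])
    linarith
  have hqabs : ∀ x, q |x| = q x := fun x => by
    rcases abs_choice x with h | h <;> rw [h]
    simp [hq, add_comm]
  rw [integral_comp_mul_cos_symmetrize p r₁ (hc.mono hsub) h0,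
    integral_comp_mul_cos_symmetrize p r₂ hc (h0.trans h12.le)]
  have key : ∀ r θ, 0 ≤ r → q (r * Real.cos θ) = q (r * |Real.cos θ|) := fun r θ hr => by
    rw [← hqabs (r * Real.cos θ), abs_mul, abs_of_nonneg hr]
  have hmem : ∀ r, 0 ≤ r → r ≤ r₂ → ∀ θ, r * |Real.cos θ| ∈ Icc 0 r₂ := fun r hr hr2 θ =>
    ⟨by positivity, by nlinarith [Real.abs_cos_le_one θ, abs_nonneg (Real.cos θ)]⟩
  have hcont : ∀ r, 0 ≤ r → r ≤ r₂ → Continuous fun θ => q (r * Real.cos θ) := fun r hr hr2 => by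
    simp_rw [key r _ hr]
    exact (hqc.mono (Icc_subset_Icc (by linarith) le_rfl)).comp_continuous (by fun_prop)
      (hmem r hr hr2)
  -- At `θ = 0` the integrands are `q r₁ < q r₂`; elsewhere a weak inequality suffices.
  refine intervalIntegral.integral_lt_integral_of_continuousOn_of_le_of_exists_lt
    (by positivity) (hcont r₁ h0 h12.le).continuousOn
    (hcont r₂ (h0.trans h12.le) le_rfl).continuousOn (fun θ _ => ?_) ⟨0, by simp; positivity, ?_⟩
  · change q _ ≤ q _
    rw [key _ _ h0, key _ _ (h0.trans h12.le)]
    refine hqmono.monotoneOn (hmem _ h0 h12.le θ) (hmem _ (h0.trans h12.le) le_rfl θ) ?_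
    gcongr
  · change q _ < q _
    rw [Real.cos_zero, mul_one, mul_one]
    exact hqmono ⟨h0, h12.le⟩ ⟨h0.trans h12.le, le_rfl⟩ h12

theorem integral_comp_mul_cos_gt {p p' : ℝ → ℝ} {r₁ r₂ : ℝ} (h0 : 0 ≤ r₁) (h12 : r₁ < r₂)
    (hp : ∀ x ∈ Icc (-r₂) r₂, HasDerivAt p (p' x) x) (hp' : StrictAntiOn p' (Icc (-r₂) r₂)) :
    ∫ θ in (0 : ℝ)..(2 * Real.pi), p (r₂ * Real.cos θ) <
      ∫ θ in (0 : ℝ)..(2 * Real.pi), p (r₁ * Real.cos θ) := by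
  have := integral_comp_mul_cos_lt h0 h12 (p := fun x => -p x) (fun x hx => (hp x hx).neg) hp'.neg
  simpa [intervalIntegral.integral_neg] using this

/-! ### Normal form coordinates along solutions. -/

namespace LienardType

/-- The square of the radius in normal form coordinates. -/
noncomputable def energy (F s : ℝ → ℝ) (q : ℝ × ℝ) : ℝ :=
  s q.1 ^ 2 + (q.2 * Real.exp (F q.1)) ^ 2

namespace IsNormalForm

variable {f g F s P R : ℝ → ℝ} {δ : ℝ}

theorem zero_mem (h : IsNormalForm f g δ F s P R) : (0 : ℝ) ∈ Ioo (-δ) δ :=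
  ⟨by linarith [h.pos], h.pos⟩

theorem continuousOn_F (h : IsNormalForm f g δ F s P R) : ContinuousOn F (Ioo (-δ) δ) :=
  fun x hx => (h.hasDerivAt_F x hx).continuousAt.continuousWithinAt

theorem continuousOn_s (h : IsNormalForm f g δ F s P R) : ContinuousOn s (Ioo (-δ) δ) :=
  fun x hx => (h.hasDerivAt_s x hx).continuousAt.continuousWithinAt

theorem strictMonoOn_s (h : IsNormalForm f g δ F s P R) : StrictMonoOn s (Ioo (-δ) δ) := by
  refine strictMonoOn_of_deriv_pos (convex_Ioo _ _) h.continuousOn_s fun x hx => ?_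
  rw [interior_Ioo] at hx
  rw [(h.hasDerivAt_s x hx).deriv]
  exact div_pos (Real.exp_pos _) (h.P_pos x hx)

theorem ordConnected_image (h : IsNormalForm f g δ F s P R) :
    OrdConnected (s '' Ioo (-δ) δ) :=
  (isPreconnected_Ioo.image s h.continuousOn_s).ordConnected

theorem image_mem_nhds (h : IsNormalForm f g δ F s P R) {v : ℝ} (hv : v ∈ s '' Ioo (-δ) δ) :
    s '' Ioo (-δ) δ ∈ 𝓝 v := by
  obtain ⟨x, hx, rfl⟩ := hv
  obtain ⟨a, ha1, ha2⟩ := exists_between hx.1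
  obtain ⟨b, hb1, hb2⟩ := exists_between hx.2
  have ha : a ∈ Ioo (-δ) δ := ⟨ha1, ha2.trans hx.2⟩
  have hb : b ∈ Ioo (-δ) δ := ⟨hx.1.trans hb1, hb2⟩
  exact mem_of_superset (Icc_mem_nhds (h.strictMonoOn_s ha hx ha2) (h.strictMonoOn_s hx hb hb1))
    (h.ordConnected_image.out (mem_image_of_mem s ha) (mem_image_of_mem s hb))

/-- The inverse of the coordinate function `s`. -/
noncomputable def inv (_ : IsNormalForm f g δ F s P R) : ℝ → ℝ :=
  Function.invFunOn s (Ioo (-δ) δ)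

theorem inv_mem (h : IsNormalForm f g δ F s P R) {v : ℝ} (hv : v ∈ s '' Ioo (-δ) δ) :
    h.inv v ∈ Ioo (-δ) δ :=
  Function.invFunOn_mem hv

theorem apply_inv (h : IsNormalForm f g δ F s P R) {v : ℝ} (hv : v ∈ s '' Ioo (-δ) δ) :
    s (h.inv v) = v :=
  Function.invFunOn_eq hv

theorem inv_apply (h : IsNormalForm f g δ F s P R) {x : ℝ} (hx : x ∈ Ioo (-δ) δ) :
    h.inv (s x) = x :=
  h.strictMonoOn_s.injOn (h.inv_mem (mem_image_of_mem s hx)) hx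
    (h.apply_inv (mem_image_of_mem s hx))

theorem inv_zero (h : IsNormalForm f g δ F s P R) : h.inv 0 = 0 := by
  have := h.inv_apply h.zero_mem
  rwa [h.s_zero] at this

theorem zero_mem_image (h : IsNormalForm f g δ F s P R) : (0 : ℝ) ∈ s '' Ioo (-δ) δ :=
  ⟨0, h.zero_mem, h.s_zero⟩

theorem strictMonoOn_inv (h : IsNormalForm f g δ F s P R) :
    StrictMonoOn h.inv (s '' Ioo (-δ) δ) := by
  rintro _ ⟨x, hx, rfl⟩ _ ⟨y, hy, rfl⟩ hxy
  rw [h.inv_apply hx, h.inv_apply hy]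
  exact (h.strictMonoOn_s.lt_iff_lt hx hy).1 hxy

theorem continuousAt_inv (h : IsNormalForm f g δ F s P R) {v : ℝ}
    (hv : v ∈ s '' Ioo (-δ) δ) : ContinuousAt h.inv v := by
  refine h.strictMonoOn_inv.continuousAt_of_image_mem_nhds (h.image_mem_nhds hv) ?_
  refine mem_of_superset (Ioo_mem_nhds (h.inv_mem hv).1 (h.inv_mem hv).2) fun x hx => ?_
  exact ⟨s x, mem_image_of_mem s hx, h.inv_apply hx⟩

/-- The factor `exp F / P` in the derivative of `P` is `ds/dx`, which cancels on passing to the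
variable `s`. -/
theorem hasDerivAt_period_density (h : IsNormalForm f g δ F s P R) {v : ℝ}
    (hv : v ∈ s '' Ioo (-δ) δ) : HasDerivAt (fun v => P (h.inv v)) (R (h.inv v)) v := by
  have hm := h.inv_mem hv
  have hne : Real.exp (F (h.inv v)) / P (h.inv v) ≠ 0 :=
    (div_pos (Real.exp_pos _) (h.P_pos _ hm)).ne'
  have hd := HasDerivAt.of_local_left_inverse (h.continuousAt_inv hv) (h.hasDerivAt_s _ hm) hne
    (mem_of_superset (h.image_mem_nhds hv) fun w hw => h.apply_inv hw)
  refine ((h.hasDerivAt_P _ hm).comp v hd).congr_deriv ?_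
  rw [mul_assoc, mul_inv_cancel₀ hne, mul_one]

theorem hasDerivAt_s_comp (h : IsNormalForm f g δ F s P R) {c : ℝ → ℝ × ℝ}
    (hc : IsSolution f g c) {t : ℝ} (ht : (c t).1 ∈ Ioo (-δ) δ) :
    HasDerivAt (fun t => s (c t).1) ((c t).2 * Real.exp (F (c t).1) / P (c t).1) t := by
  have h1 : HasDerivAt (fun t => (c t).1) (c t).2 t := (hc t).fst
  refine ((h.hasDerivAt_s _ ht).comp t h1).congr_deriv (by ring)

theorem hasDerivAt_w_comp (h : IsNormalForm f g δ F s P R) {c : ℝ → ℝ × ℝ}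
    (hc : IsSolution f g c) {t : ℝ} (ht : (c t).1 ∈ Ioo (-δ) δ) :
    HasDerivAt (fun t => (c t).2 * Real.exp (F (c t).1)) (-(s (c t).1 / P (c t).1)) t := by
  have h1 : HasDerivAt (fun t => (c t).1) (c t).2 t := (hc t).fst
  have h2 : HasDerivAt (fun t => (c t).2) (-g (c t).1 - f (c t).1 * (c t).2 ^ 2) t := (hc t).snd
  refine (h2.mul ((h.hasDerivAt_F _ ht).comp t h1).exp).congr_deriv ?_
  have := (h.P_pos _ ht).ne'
  rw [h.s_eq _ ht]
  simp only [Function.comp]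
  field_simp
  ring

theorem hasDerivAt_energy_comp (h : IsNormalForm f g δ F s P R) {c : ℝ → ℝ × ℝ}
    (hc : IsSolution f g c) {t : ℝ} (ht : (c t).1 ∈ Ioo (-δ) δ) :
    HasDerivAt (fun t => energy F s (c t)) 0 t := by
  refine (((h.hasDerivAt_s_comp hc ht).pow 2).add
    ((h.hasDerivAt_w_comp hc ht).pow 2)).congr_deriv ?_
  push_cast
  ring

theorem continuousOn_energy (h : IsNormalForm f g δ F s P R) :
    ContinuousOn (energy F s) (Prod.fst ⁻¹' Ioo (-δ) δ) := by
  have h1 : ContinuousOn (fun q : ℝ × ℝ => s q.1) (Prod.fst ⁻¹' Ioo (-δ) δ) :=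
    h.continuousOn_s.comp continuousOn_fst fun _ hq => hq
  have h2 : ContinuousOn (fun q : ℝ × ℝ => F q.1) (Prod.fst ⁻¹' Ioo (-δ) δ) :=
    h.continuousOn_F.comp continuousOn_fst fun _ hq => hq
  exact (h1.pow 2).add ((continuousOn_snd.mul h2.rexp).pow 2)

theorem eq_of_coords_eq (h : IsNormalForm f g δ F s P R) {q q' : ℝ × ℝ}
    (hq : q.1 ∈ Ioo (-δ) δ) (hq' : q'.1 ∈ Ioo (-δ) δ) (hs : s q.1 = s q'.1)
    (hw : q.2 * Real.exp (F q.1) = q'.2 * Real.exp (F q'.1)) : q = q' := by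
  have h1 := h.strictMonoOn_s.injOn hq hq' hs
  rw [h1] at hw
  exact Prod.ext h1 (mul_right_cancel₀ (Real.exp_ne_zero _) hw)

/-- Polar coordinates without lifting an angle: `Θ` is defined by integrating the known speed `1 /
P`, and the coordinates rotated back by `Θ` are constant. -/
theorem exists_angle (h : IsNormalForm f g δ F s P R) {c : ℝ → ℝ × ℝ}
    (hc : IsSolution f g c) (hI : ∀ t, (c t).1 ∈ Ioo (-δ) δ) :
    ∃ (r : ℝ) (Θ : ℝ → ℝ), 0 ≤ r ∧ (∀ t, HasDerivAt Θ (1 / P (c t).1) t) ∧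
      ∀ t, s (c t).1 = r * Real.cos (Θ t) ∧
        (c t).2 * Real.exp (F (c t).1) = -(r * Real.sin (Θ t)) := by
  have hcx : Continuous fun t => (c t).1 :=
    continuous_iff_continuousAt.2 fun t => (HasDerivAt.continuousAt (hc t)).fst
  have hPc : Continuous fun t => 1 / P (c t).1 := by
    have : Continuous fun t => P (c t).1 := continuous_iff_continuousAt.2 fun t =>
      ContinuousAt.comp (f := fun t => (c t).1) (h.hasDerivAt_P _ (hI t)).continuousAt
        hcx.continuousAt
    exact continuous_const.div this fun t => (h.P_pos _ (hI t)).ne'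
  -- The motion is clockwise; negating the second coordinate makes the angle increase.
  set z : ℂ := ⟨s (c 0).1, -((c 0).2 * Real.exp (F (c 0).1))⟩ with hz
  set Θ : ℝ → ℝ := fun t => z.arg + ∫ u in (0 : ℝ)..t, 1 / P (c u).1 with hΘ
  have hΘ' : ∀ t, HasDerivAt Θ (1 / P (c t).1) t := fun t =>
    (intervalIntegral.integral_hasDerivAt_right (hPc.intervalIntegrable _ _)
      (hPc.stronglyMeasurableAtFilter _ _) hPc.continuousAt).const_add _
  refine ⟨‖z‖, Θ, norm_nonneg _, hΘ', fun t => ?_⟩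
  have hΘ0 : Θ 0 = z.arg := by simp [hΘ]
  have hre : s (c 0).1 = ‖z‖ * Real.cos (Θ 0) := by
    rw [hΘ0, Complex.norm_mul_cos_arg]
  have him : (c 0).2 * Real.exp (F (c 0).1) = -(‖z‖ * Real.sin (Θ 0)) := by
    rw [hΘ0, Complex.norm_mul_sin_arg, hz, neg_neg]
  have hu : ∀ t, HasDerivAt (fun t => s (c t).1 * Real.cos (Θ t) -
      (c t).2 * Real.exp (F (c t).1) * Real.sin (Θ t)) 0 t := fun t =>
    (((h.hasDerivAt_s_comp hc (hI t)).mul (hΘ' t).cos).sub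
      ((h.hasDerivAt_w_comp hc (hI t)).mul (hΘ' t).sin)).congr_deriv (by ring)
  have hv : ∀ t, HasDerivAt (fun t => s (c t).1 * Real.sin (Θ t) +
      (c t).2 * Real.exp (F (c t).1) * Real.cos (Θ t)) 0 t := fun t =>
    (((h.hasDerivAt_s_comp hc (hI t)).mul (hΘ' t).sin).add
      ((h.hasDerivAt_w_comp hc (hI t)).mul (hΘ' t).cos)).congr_deriv (by ring)
  have hu' := is_const_of_deriv_eq_zero (fun t => (hu t).differentiableAt)
    (fun t => (hu t).deriv) t 0
  have hv' := is_const_of_deriv_eq_zero (fun t => (hv t).differentiableAt)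
    (fun t => (hv t).deriv) t 0
  simp only [hre, him] at hu' hv'
  have h0 := Real.sin_sq_add_cos_sq (Θ 0)
  have ht := Real.sin_sq_add_cos_sq (Θ t)
  constructor
  · linear_combination Real.cos (Θ t) * hu' + Real.sin (Θ t) * hv' +
      ‖z‖ * Real.cos (Θ t) * h0 - s (c t).1 * ht
  · linear_combination -Real.sin (Θ t) * hu' + Real.cos (Θ t) * hv' -
      ‖z‖ * Real.sin (Θ t) * h0 - (c t).2 * Real.exp (F (c t).1) * ht

end IsNormalForm

end LienardType

theorem surjective_of_hasDerivAt_ge {Θ θ' : ℝ → ℝ} {m : ℝ} (hm : 0 < m)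
    (hd : ∀ t, HasDerivAt Θ (θ' t) t) (hge : ∀ t, m ≤ θ' t) : Function.Surjective Θ := by
  have hcont : Continuous Θ := continuous_iff_continuousAt.2 fun t => (hd t).continuousAt
  have hd' : ∀ t, HasDerivAt (fun t => Θ t - m * t) (θ' t - m) t := fun t =>
    ((hd t).sub ((hasDerivAt_id t).const_mul m)).congr_deriv (by ring)
  have hmono : Monotone fun t => Θ t - m * t :=
    monotone_of_deriv_nonneg (fun t => (hd' t).differentiableAt) fun t => by
      rw [(hd' t).deriv]; linarith [hge t]
  refine hcont.surjective ?_ ?_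
  · refine tendsto_atTop_mono' atTop (f₁ := fun t => Θ 0 + m * t) ?_
      (tendsto_atTop_add_const_left _ _ (tendsto_id.const_mul_atTop hm))
    filter_upwards [eventually_ge_atTop 0] with t ht
    have := hmono ht
    simp only [mul_zero, sub_zero] at this
    linarith
  · refine tendsto_atBot_mono' atBot (f₁ := fun t => Θ 0 + m * t) ?_
      (tendsto_atBot_add_const_left _ _ (tendsto_id.const_mul_atBot hm))
    filter_upwards [eventually_le_atBot 0] with t ht
    have := hmono ht
    simp only [mul_zero, sub_zero] at this
    linarith

/-! ### Cycles: radius, period, enclosure and trapping. -/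

namespace LienardType.IsNormalForm

variable {f g F s P R : ℝ → ℝ} {δ : ℝ}

/-- A cycle in the strip where the normal form is valid is a full level set of the energy, and
its period is given by the period integral. -/
theorem exists_radius (h : IsNormalForm f g δ F s P R) {γ : Set (ℝ × ℝ)} {T : ℝ}
    (hγ : IsCycle f g γ T) (hsub : γ ⊆ Prod.fst ⁻¹' Ioo (-δ) δ) :
    ∃ r > 0, (∀ q : ℝ × ℝ, q.1 ∈ Ioo (-δ) δ → (q ∈ γ ↔ energy F s q = r ^ 2)) ∧
      Icc (-r) r ⊆ s '' Ioo (-δ) δ ∧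
      T = ∫ θ in (0 : ℝ)..(2 * Real.pi), P (h.inv (r * Real.cos θ)) := by
  obtain ⟨c, hc, rfl, hT⟩ := hγ
  have hI : ∀ t, (c t).1 ∈ Ioo (-δ) δ := fun t => hsub (mem_range_self t)
  obtain ⟨r, Θ, hr0, hΘ, hrot⟩ := h.exists_angle hc hI
  have hr : 0 < r := by
    refine hr0.lt_of_ne fun hr => ?_
    -- Radius `0` would make the solution constant, and then `T / 2` would be a smaller period.
    have hconst : ∀ t t', c t = c t' := fun t t' =>
      h.eq_of_coords_eq (hI t) (hI t') (by rw [(hrot t).1, (hrot t').1, ← hr]; simp)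
        (by rw [(hrot t).2, (hrot t').2, ← hr]; simp)
    have := hT.2 ⟨half_pos hT.1.1, fun t => hconst _ _⟩
    linarith [hT.1.1]
  have hpos : ∀ t, 0 < 1 / P (c t).1 := fun t => one_div_pos.2 (h.P_pos _ (hI t))
  have hsurj : Function.Surjective Θ := surjective_of_hasDerivAt_ge (m := 1 / 2) (by norm_num) hΘ
    fun t => one_div_le_one_div_of_le (h.P_pos _ (hI t)) (h.P_le _ (hI t))
  have hΘmono : StrictMono Θ := strictMono_of_deriv_pos fun t => by
    rw [(hΘ t).deriv]; exact hpos t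
  have hJ : ∀ θ, r * Real.cos θ ∈ s '' Ioo (-δ) δ := fun θ => by
    obtain ⟨t, rfl⟩ := hsurj θ
    exact ⟨_, hI t, (hrot t).1⟩
  have hIcc : Icc (-r) r ⊆ s '' Ioo (-δ) δ := by
    refine h.ordConnected_image.out ?_ ?_
    · simpa using hJ Real.pi
    · simpa using hJ 0
  set p : ℝ → ℝ := fun θ => P (h.inv (r * Real.cos θ)) with hp
  have hpc : Continuous p := continuous_iff_continuousAt.2 fun θ =>
    ContinuousAt.comp (f := fun θ => r * Real.cos θ)
      (h.hasDerivAt_period_density (hJ θ)).continuousAt (by fun_prop)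
  have hppos : ∀ θ, 0 < p θ := fun θ => h.P_pos _ (h.inv_mem (hJ θ))
  have hpper : Function.Periodic p (2 * Real.pi) := fun θ => by
    simp only [hp, Real.cos_add_two_pi]
  -- `Q` measures time as a function of the angle, as `dt = p(θ) dθ`; one full turn takes time `Q
  -- (2π)`.
  set Q : ℝ → ℝ := fun θ => ∫ u in (0 : ℝ)..θ, p u with hQ
  have hQd : ∀ θ, HasDerivAt Q (p θ) θ := fun θ =>
    intervalIntegral.integral_hasDerivAt_right (hpc.intervalIntegrable _ _)
      (hpc.stronglyMeasurableAtFilter _ _) hpc.continuousAt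
  have hQmono : StrictMono Q := strictMono_of_deriv_pos fun θ => by
    rw [(hQd θ).deriv]; exact hppos θ
  have hQper : ∀ θ, Q (θ + 2 * Real.pi) = Q θ + Q (2 * Real.pi) := fun θ => by
    simp only [hQ]
    rw [← intervalIntegral.integral_add_adjacent_intervals (b := θ)
      (hpc.intervalIntegrable _ _) (hpc.intervalIntegrable _ _),
      hpper.intervalIntegral_add_eq θ 0, zero_add]
  have hpΘ : ∀ t, p (Θ t) = P (c t).1 := fun t => by
    simp only [hp]
    rw [← (hrot t).1, h.inv_apply (hI t)]
  have htime : ∀ t, Q (Θ t) = t + Q (Θ 0) := fun t => by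
    have hd : ∀ t, HasDerivAt (fun t => Q (Θ t) - t) 0 t := fun t => by
      refine (((hQd (Θ t)).comp t (hΘ t)).sub (hasDerivAt_id t)).congr_deriv ?_
      rw [hpΘ, mul_one_div_cancel (h.P_pos _ (hI t)).ne', sub_self]
    have := is_const_of_deriv_eq_zero (fun t => (hd t).differentiableAt)
      (fun t => (hd t).deriv) t 0
    linarith
  have hleast : IsLeast {τ : ℝ | 0 < τ ∧ Function.Periodic c τ} (Q (2 * Real.pi)) := by
    refine ⟨⟨?_, fun t => ?_⟩, ?_⟩
    · have h0 : Q 0 = 0 := by simp [hQ]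
      rw [← h0]
      exact hQmono (by positivity)
    · have hshift : Θ (t + Q (2 * Real.pi)) = Θ t + 2 * Real.pi := by
        apply hQmono.injective
        rw [hQper, htime, htime t]
        ring
      refine h.eq_of_coords_eq (hI _) (hI _) ?_ ?_
      · rw [(hrot _).1, (hrot t).1, hshift, Real.cos_add_two_pi]
      · rw [(hrot _).2, (hrot t).2, hshift, Real.sin_add_two_pi]
    · rintro τ ⟨hτ, hper⟩
      have h0 : c τ = c 0 := by simpa using hper 0
      have hcos : Real.cos (Θ τ) = Real.cos (Θ 0) := by
        have := (hrot τ).1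
        rw [h0, (hrot 0).1] at this
        exact (mul_left_cancel₀ hr.ne' this).symm
      have hsin : Real.sin (Θ τ) = Real.sin (Θ 0) := by
        have := (hrot τ).2
        rw [h0, (hrot 0).2] at this
        exact (mul_left_cancel₀ hr.ne' (neg_injective this)).symm
      -- Returning to the initial point means turning by a multiple of `2π`, at least one full turn
      -- because `Θ` increases.
      have hc1 : Real.cos (Θ τ - Θ 0) = 1 := by
        rw [Real.cos_sub, hcos, hsin]
        linarith [Real.sin_sq_add_cos_sq (Θ 0)]
      obtain ⟨n, hn⟩ := (Real.cos_eq_one_iff _).1 hc1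
      have hlt := hΘmono hτ
      have hn1 : (1 : ℝ) ≤ n := by
        have : (0 : ℝ) < n := by
          by_contra hcon
          nlinarith [Real.pi_pos, not_lt.1 hcon]
        exact_mod_cast this
      have hle : Θ 0 + 2 * Real.pi ≤ Θ τ := by nlinarith [Real.pi_pos]
      have := hQmono.monotone hle
      rw [hQper, htime τ] at this
      linarith
  refine ⟨r, hr, fun q hq => ⟨?_, fun he => ?_⟩, hIcc, hT.unique hleast⟩
  · rintro ⟨t, rfl⟩
    rw [energy, (hrot t).1, (hrot t).2]
    linear_combination r ^ 2 * Real.sin_sq_add_cos_sq (Θ t)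
  · set z : ℂ := ⟨s q.1, -(q.2 * Real.exp (F q.1))⟩ with hz
    have hn : ‖z‖ = r := by
      rw [← sq_eq_sq₀ (norm_nonneg _) hr0, Complex.sq_norm, Complex.normSq_apply, ← he, energy]
      ring
    obtain ⟨t, ht⟩ := hsurj z.arg
    refine ⟨t, h.eq_of_coords_eq (hI t) hq ?_ ?_⟩
    · rw [(hrot t).1, ht, ← hn, Complex.norm_mul_cos_arg]
    · rw [(hrot t).2, ht, ← hn, Complex.norm_mul_sin_arg, hz, neg_neg]

theorem energy_zero_left (h : IsNormalForm f g δ F s P R) (y : ℝ) :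
    energy F s (0, y) = y ^ 2 := by
  simp [energy, h.F_zero, h.s_zero]

/-- No Jordan curve theorem is needed: if `r₂ < r₁`, the vertical ray going up from `(0, r₁)` misses
`γ₂`, so that point of `γ₁` lies in an unbounded component. -/
theorem radius_lt_of_subset_inside (h : IsNormalForm f g δ F s P R) {γ₁ γ₂ : Set (ℝ × ℝ)}
    {r₁ r₂ : ℝ} (hr₁ : 0 < r₁) (hr₂ : 0 < r₂)
    (h₁ : ∀ q : ℝ × ℝ, q.1 ∈ Ioo (-δ) δ → (q ∈ γ₁ ↔ energy F s q = r₁ ^ 2))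
    (h₂ : ∀ q : ℝ × ℝ, q.1 ∈ Ioo (-δ) δ → (q ∈ γ₂ ↔ energy F s q = r₂ ^ 2))
    (hin : γ₁ ⊆ inside γ₂) : r₁ < r₂ := by
  by_contra! hle
  have hmem : ((0 : ℝ), r₁) ∈ γ₁ := (h₁ _ h.zero_mem).2 (h.energy_zero_left r₁)
  obtain ⟨hnot, hbdd⟩ := hin hmem
  have hne : r₂ < r₁ := by
    refine hle.lt_of_ne ?_
    rintro rfl
    exact hnot ((h₂ _ h.zero_mem).2 (h.energy_zero_left r₂))
  have hray : Prod.mk (0 : ℝ) '' Ici r₁ ⊆ connectedComponentIn γ₂ᶜ (0, r₁) := by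
    refine (isPreconnected_Ici.image _ (by fun_prop)).subset_connectedComponentIn
      (mem_image_of_mem _ self_mem_Ici) ?_
    rintro _ ⟨y, hy, rfl⟩ hy2
    have := (h₂ _ h.zero_mem).1 hy2
    rw [h.energy_zero_left] at this
    have hy' : r₁ ≤ y := hy
    nlinarith
  obtain ⟨M, hM⟩ := (hbdd.subset hray).exists_norm_le
  have := hM _ (mem_image_of_mem _ (mem_Ici.2 (le_max_left r₁ (M + 1))))
  have h1 := (norm_snd_le ((0 : ℝ), max r₁ (M + 1))).trans this
  have h2 := (le_abs_self _).trans h1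
  have h3 := le_max_right r₁ (M + 1)
  simp only at h2
  linarith

/-- Orbits starting in a small sublevel set of the energy stay in it. -/
theorem trapped (h : IsNormalForm f g δ F s P R) {c : ℝ → ℝ × ℝ} (hc : IsSolution f g c)
    {r t₀ : ℝ} (hr : 0 < r) (hJ : Icc (-r) r ⊆ s '' Ioo (-δ) δ)
    (h0 : (c t₀).1 ∈ Ioo (-δ) δ) (he : energy F s (c t₀) ≤ r ^ 2) (t : ℝ) :
    (c t).1 ∈ Ioo (-δ) δ ∧ energy F s (c t) ≤ r ^ 2 := by
  have hcc : Continuous c := continuous_iff_continuousAt.2 fun t => HasDerivAt.continuousAt (hc t)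
  have hl : -r ∈ s '' Ioo (-δ) δ := hJ ⟨le_rfl, by linarith⟩
  have hu : r ∈ s '' Ioo (-δ) δ := hJ ⟨by linarith, le_rfl⟩
  set V : Set (ℝ × ℝ) := {q | q.1 ∈ Ioo (-δ) δ ∧ energy F s q ≤ r ^ 2} with hV
  have hK : Icc (h.inv (-r)) (h.inv r) ⊆ Ioo (-δ) δ := fun x hx =>
    ⟨(h.inv_mem hl).1.trans_le hx.1, hx.2.trans_lt (h.inv_mem hu).2⟩
  -- The energy bound confines the first coordinate to a compact subinterval, which makes `V` closed
  -- although the strip is open. Then `c ⁻¹' V` is clopen, as energy is locally conserved.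
  have hVeq : V = Prod.fst ⁻¹' Icc (h.inv (-r)) (h.inv r) ∩ energy F s ⁻¹' Iic (r ^ 2) := by
    ext q
    refine ⟨fun ⟨hq, hq2⟩ => ⟨?_, hq2⟩, fun ⟨hq, hq2⟩ => ⟨hK hq, hq2⟩⟩
    have hs : s q.1 ^ 2 ≤ r ^ 2 := by
      unfold energy at hq2
      nlinarith [sq_nonneg (q.2 * Real.exp (F q.1))]
    obtain ⟨h1, h2⟩ := abs_le.1 (abs_le_of_sq_le_sq hs hr.le)
    rw [mem_preimage, ← h.inv_apply hq]
    have hm := mem_image_of_mem s hq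
    exact ⟨h.strictMonoOn_inv.monotoneOn hl hm h1, h.strictMonoOn_inv.monotoneOn hm hu h2⟩
  have hVclosed : IsClosed V := by
    rw [hVeq]
    exact (h.continuousOn_energy.mono (preimage_mono hK)).preimage_isClosed_of_isClosed
      (isClosed_Icc.preimage continuous_fst) isClosed_Iic
  have hopen : IsOpen (c ⁻¹' V) := by
    refine isOpen_iff_mem_nhds.2 fun t ht => ?_
    have hstrip : c ⁻¹' (Prod.fst ⁻¹' Ioo (-δ) δ) ∈ 𝓝 t :=
      ((isOpen_Ioo.preimage continuous_fst).preimage hcc).mem_nhds ht.1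
    obtain ⟨ε, hε, hball⟩ := Metric.mem_nhds_iff.1 hstrip
    refine mem_of_superset (Metric.ball_mem_nhds t hε) fun u hu => ⟨hball hu, ?_⟩
    have := Metric.isOpen_ball.is_const_of_deriv_eq_zero (convex_ball t ε).isPreconnected
      (fun v hv => (h.hasDerivAt_energy_comp hc (hball hv)).differentiableAt.differentiableWithinAt)
      (fun v hv => (h.hasDerivAt_energy_comp hc (hball hv)).deriv) hu (Metric.mem_ball_self hε)
    exact this.trans_le ht.2
  have huniv : c ⁻¹' V = univ :=
    IsClopen.eq_univ ⟨hVclosed.preimage hcc, hopen⟩ ⟨t₀, h0, he⟩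
  have : t ∈ c ⁻¹' V := huniv ▸ mem_univ t
  exact this

theorem exists_sublevel_subset (h : IsNormalForm f g δ F s P R) {U : Set (ℝ × ℝ)}
    (hU : U ∈ 𝓝 (0 : ℝ × ℝ)) : ∃ r > 0, Icc (-r) r ⊆ s '' Ioo (-δ) δ ∧
      {q : ℝ × ℝ | q.1 ∈ Ioo (-δ) δ ∧ energy F s q ≤ r ^ 2} ⊆ U := by
  -- `Ψ` inverts the coordinates `(s, w)`; its continuity at `0` carries a small disc into `U`.
  set Ψ : ℝ × ℝ → ℝ × ℝ := fun v => (h.inv v.1, v.2 * Real.exp (-F (h.inv v.1))) with hΨ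
  have hinv : ContinuousAt (fun v : ℝ × ℝ => h.inv v.1) 0 :=
    ContinuousAt.comp (f := Prod.fst) (h.continuousAt_inv h.zero_mem_image) continuousAt_fst
  have hF : ContinuousAt (fun v : ℝ × ℝ => F (h.inv v.1)) 0 := by
    refine ContinuousAt.comp (f := fun v : ℝ × ℝ => h.inv v.1) ?_ hinv
    simp only [Prod.fst_zero, h.inv_zero]
    exact (h.hasDerivAt_F 0 h.zero_mem).continuousAt
  have hΨc : ContinuousAt Ψ 0 := hinv.prodMk (continuousAt_snd.mul hF.neg.rexp)
  have hΨ0 : Ψ 0 = 0 := by simp [hΨ, h.inv_zero]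
  have hpre : Ψ ⁻¹' U ∈ 𝓝 (0 : ℝ × ℝ) := hΨc (by rwa [hΨ0])
  obtain ⟨ε₁, hε₁, hb₁⟩ := Metric.mem_nhds_iff.1 hpre
  obtain ⟨ε₂, hε₂, hb₂⟩ := Metric.mem_nhds_iff.1 (h.image_mem_nhds h.zero_mem_image)
  refine ⟨min ε₁ ε₂ / 2, by positivity, fun x hx => hb₂ ?_, ?_⟩
  · rw [mem_ball_zero_iff, Real.norm_eq_abs]
    exact (abs_le.2 hx).trans_lt ((half_lt_self (by positivity)).trans_le (min_le_right _ _))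
  · rintro q ⟨hq, hq2⟩
    have hlt : min ε₁ ε₂ / 2 < ε₁ := (half_lt_self (by positivity)).trans_le (min_le_left _ _)
    have hpos : 0 ≤ min ε₁ ε₂ / 2 := by positivity
    unfold energy at hq2
    have h1 : |s q.1| ≤ min ε₁ ε₂ / 2 := 
      abs_le_of_sq_le_sq (by nlinarith [sq_nonneg (q.2 * Real.exp (F q.1))]) hpos
    have h2 : |q.2 * Real.exp (F q.1)| ≤ min ε₁ ε₂ / 2 :=
      abs_le_of_sq_le_sq (by nlinarith [sq_nonneg (s q.1)]) hpos
    have hm : (s q.1, q.2 * Real.exp (F q.1)) ∈ Ψ ⁻¹' U := hb₁ (by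
      rw [mem_ball_zero_iff, Prod.norm_def]
      exact max_lt (h1.trans_lt hlt) (h2.trans_lt hlt))
    have hval : Ψ (s q.1, q.2 * Real.exp (F q.1)) = q := by
      simp only [hΨ, h.inv_apply hq, mul_assoc, ← Real.exp_add, add_neg_cancel, Real.exp_zero,
        mul_one]
    rwa [mem_preimage, hval] at hm

/-- Near an isochronous center, the period integral does not depend on the radius. -/
theorem exists_period_integral_eq (h : IsNormalForm f g δ F s P R)
    (hi : IsIsochronousCenter f g) : ∃ r₁ r₂, 0 < r₁ ∧ r₁ < r₂ ∧
      Icc (-r₂) r₂ ⊆ s '' Ioo (-δ) δ ∧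
      ∫ θ in (0 : ℝ)..(2 * Real.pi), P (h.inv (r₁ * Real.cos θ)) =
        ∫ θ in (0 : ℝ)..(2 * Real.pi), P (h.inv (r₂ * Real.cos θ)) := by
  obtain ⟨⟨-, hcyc⟩, T₀, U, hU, hT₀⟩ := hi
  rw [eventually_nhdsWithin_iff] at hcyc
  obtain ⟨r, hr, hJ, hrU⟩ := h.exists_sublevel_subset (inter_mem hU hcyc)
  have key : ∀ ρ, 0 < ρ → ρ ≤ r →
      ∫ θ in (0 : ℝ)..(2 * Real.pi), P (h.inv (ρ * Real.cos θ)) = T₀ := by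
    intro ρ hρ hρr
    have hV : ((0 : ℝ), ρ) ∈ {q : ℝ × ℝ | q.1 ∈ Ioo (-δ) δ ∧ energy F s q ≤ r ^ 2} :=
      ⟨h.zero_mem, by rw [h.energy_zero_left]; gcongr⟩
    obtain ⟨γ, T, hmem, hγ⟩ := (hrU hV).2 (by simp [Prod.ext_iff, hρ.ne'])
    -- The center hypothesis only gives a cycle through the point; trapping shows that it stays in
    -- the strip and in `U`.
    have hsub : γ ⊆ {q : ℝ × ℝ | q.1 ∈ Ioo (-δ) δ ∧ energy F s q ≤ r ^ 2} := by
      obtain ⟨c, hc, rfl, -⟩ := hγ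
      obtain ⟨t₀, ht₀⟩ := hmem
      rintro _ ⟨t, rfl⟩
      exact h.trapped hc (t₀ := t₀) hr hJ (by rw [ht₀]; exact hV.1) (by rw [ht₀]; exact hV.2) t
    obtain ⟨ρ', hρ', hlevel, -, hT⟩ := h.exists_radius hγ fun q hq => (hsub hq).1
    have hsq := (hlevel _ h.zero_mem).1 hmem
    rw [h.energy_zero_left, sq_eq_sq₀ hρ.le hρ'.le] at hsq
    rw [hsq, ← hT]
    exact hT₀ γ T hγ fun q hq => (hrU (hsub hq)).1
  exact ⟨r / 2, r, half_pos hr, half_lt_self hr, hJ,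
    (key _ (half_pos hr) (half_le_self hr.le)).trans (key r hr le_rfl).symm⟩

theorem strictMonoOn_density_deriv (h : IsNormalForm f g δ F s P R) {r : ℝ}
    (hR : StrictMonoOn R (Ioo (-δ) δ)) (hJ : Icc (-r) r ⊆ s '' Ioo (-δ) δ) :
    StrictMonoOn (fun v => R (h.inv v)) (Icc (-r) r) := fun _ ha _ hb hab =>
  hR (h.inv_mem (hJ ha)) (h.inv_mem (hJ hb)) (h.strictMonoOn_inv (hJ ha) (hJ hb) hab)

theorem strictAntiOn_density_deriv (h : IsNormalForm f g δ F s P R) {r : ℝ}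
    (hR : StrictAntiOn R (Ioo (-δ) δ)) (hJ : Icc (-r) r ⊆ s '' Ioo (-δ) δ) :
    StrictAntiOn (fun v => R (h.inv v)) (Icc (-r) r) := fun _ ha _ hb hab =>
  hR (h.inv_mem (hJ ha)) (h.inv_mem (hJ hb)) (h.strictMonoOn_inv (hJ ha) (hJ hb) hab)

theorem strip_mem_nhds (h : IsNormalForm f g δ F s P R) :
    (Prod.fst ⁻¹' Ioo (-δ) δ : Set (ℝ × ℝ)) ∈ 𝓝 (0 : ℝ × ℝ) :=
  (isOpen_Ioo.preimage continuous_fst).mem_nhds h.zero_mem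

end LienardType.IsNormalForm

theorem mainTheorem6 (f g : ℝ → ℝ) (hf : AnalyticAt ℝ f 0) (hg : AnalyticAt ℝ g 0)
    (hg' : deriv g 0 = 1) (hc : LienardType.IsCenter f g) :
    (0 < LienardType.S f g → LienardType.PeriodIncreasesNearZero f g) ∧
    (LienardType.S f g < 0 → LienardType.PeriodDecreasesNearZero f g) ∧
    (LienardType.IsIsochronousCenter f g → LienardType.S f g = 0) := by
  have hg0 : g 0 = 0 := by
    have := congrArg Prod.snd hc.1
    simpa [LienardType.field] using this
  obtain ⟨δ, F, s, P, R, h, hmono, hanti⟩ := LienardType.exists_isNormalForm hf hg hg0 hg'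
  refine ⟨fun hS => ⟨_, h.strip_mem_nhds, ?_⟩, fun hS => ⟨_, h.strip_mem_nhds, ?_⟩, fun hi => ?_⟩
  · intro γ₁ γ₂ T₁ T₂ hγ₁ hγ₂ hs₁ hs₂ hin
    obtain ⟨r₁, hr₁, hl₁, -, hT₁⟩ := h.exists_radius hγ₁ hs₁
    obtain ⟨r₂, hr₂, hl₂, hJ, hT₂⟩ := h.exists_radius hγ₂ hs₂
    rw [hT₁, hT₂]
    exact integral_comp_mul_cos_lt hr₁.le
      (h.radius_lt_of_subset_inside hr₁ hr₂ hl₁ hl₂ hin)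
      (fun v hv => h.hasDerivAt_period_density (hJ hv))
      (h.strictMonoOn_density_deriv (hmono hS) hJ)
  · intro γ₁ γ₂ T₁ T₂ hγ₁ hγ₂ hs₁ hs₂ hin
    obtain ⟨r₁, hr₁, hl₁, -, hT₁⟩ := h.exists_radius hγ₁ hs₁
    obtain ⟨r₂, hr₂, hl₂, hJ, hT₂⟩ := h.exists_radius hγ₂ hs₂
    rw [hT₁, hT₂]
    exact integral_comp_mul_cos_gt hr₁.le
      (h.radius_lt_of_subset_inside hr₁ hr₂ hl₁ hl₂ hin)
      (fun v hv => h.hasDerivAt_period_density (hJ hv))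
      (h.strictAntiOn_density_deriv (hanti hS) hJ)
  · obtain ⟨r₁, r₂, hr₁, h12, hJ, heq⟩ := h.exists_period_integral_eq hi
    rcases lt_trichotomy (LienardType.S f g) 0 with hS | hS | hS
    · exact absurd heq (integral_comp_mul_cos_gt hr₁.le h12
        (fun v hv => h.hasDerivAt_period_density (hJ hv))
        (h.strictAntiOn_density_deriv (hanti hS) hJ)).ne'
    · exact hS
    · exact absurd heq (integral_comp_mul_cos_lt hr₁.le h12
        (fun v hv => h.hasDerivAt_period_density (hJ hv))
        (h.strictMonoOn_density_deriv (hmono hS) hJ)).ne
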